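/- **Setup.** Let $\kappa$ be a perfect field of characteristic $p$ and let $\mathbb{F}$ be a ($1$-dimensional, commutative) formal group of height $n$ over $\kappa$; let $\operatorname{Aut}(\mathbb{F}/\kappa)$ be its automorphism group. Let $\mathbb{L}=\mathbb{Z}_p^{n}$ and let $\mathbb{T}=\mathbb{L}^*$ be its Pontryagin dual. An *endoisogeny* of $\mathbb{T}$ is an endomorphism with finite kernel; these form a monoid $\operatorname{Isog}(\mathbb{T})$. For $\varphi\in\operatorname{Isog}(\mathbb{T})$ let $\varphi^*\colon\mathbb{L}\to\mathbb{L}$ be its Pontryagin dual. *Deformations with level structure.* A complete local ring is a local ring $(R,\mathfrak{m})$ with $R\cong\lim_k R/\mathfrak{m}^k$; maps are local homomorphisms, and $\pi\colon R\to R/\mathfrak{m}$ is the quotient map. For a finite abelian $p$-group $A$, a deformation of $\mathbb{F}/\kappa$ to $R$ with level structure is a triple $(l\colon A\to\mathbb{G},i,\tau)$, where $\mathbb{G}$ is a formal group over $R$, $i\colon\kappa\to R/\mathfrak{m}$ is a map of fields, $\tau\colon\pi^*\mathbb{G}\cong i^*\mathbb{F}$ is an isomorphism, and $l$ is a (Drinfeld)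 level structure: a homomorphism $l\colon A\to\mathbb{G}(R)=(\mathfrak{m},+_{\mathbb{G}})$ such that, in a coordinate $x$, $\prod_{a\in A[p]}(x-l(a))$ divides $[p]_{\mathbb{G}}(x)$. A $\star$-isomorphism $(l,i,\tau)\to(l',i',\tau')$ exists only if $i=i'$ and is then an isomorphism $\delta\colon\mathbb{G}\to\mathbb{G}'$ with $\tau'\circ\pi^*\delta=\tau$ and $\delta\circ l=l'$. Let $\mathrm{Level}(A)$ be the functor sending $R$ to deformations with level structure up to $\star$-isomorphism, let $\mathcal{O}_{\mathrm{Level}(A)}$ be its ring of functions (natural transformations to the affine line, equivalently the complete local ring corepresenting it), and let $$\mathcal{O}_{\mathrm{Level}(\mathbb{T})}=\operatorname{colim}_k\mathcal{O}_{\mathrm{Level}(\mathbb{T}[p^k])},\qquad C_0=\mathbb{Q}\otimes\mathcal{O}_{\mathrm{Level}(\mathbb{T})}.$$ *Actions on $C_0$.* An automorphism $s\in\operatorname{Aut}(\mathbb{F}/\kappa)$ acts by $s\cdot(l,i,\tau)=(l,i,(i^*s)\circ\tau)$. An endoisogeny $\varphi$ of $\mathbb{T}$ with kernel $H$ of order $p^k$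 acts by $$\varphi\cdot(l,i,\tau)=\bigl((l/H)\circ\psi^{-1},\ i\circ\sigma^k,\ \tau/H\bigr).$$ Here $\sigma$ is the Frobenius of $\kappa$; $q\colon\mathbb{G}\to\mathbb{G}/H$ is the quotient by the subgroup scheme $l(H)=\sum_{h\in H}[l(h)]$; $l/H\colon\mathbb{T}/H\to\mathbb{G}/H$ is the induced level structure; $\psi\colon\mathbb{T}/H\cong\mathbb{T}$ is the isomorphism induced by $\varphi$; and $\tau/H\colon\pi^*(\mathbb{G}/H)\cong(i\sigma^k)^*\mathbb{F}$ is the unique isomorphism with $(\tau/H)\circ\pi^*q=i^*\mathrm{Frob}^k\circ\tau$, where $\mathrm{Frob}^k\colon\mathbb{F}\to(\sigma^k)^*\mathbb{F}$ is the relative Frobenius. These induce right actions of $\operatorname{Aut}(\mathbb{F}/\kappa)$ and of $\operatorname{Isog}(\mathbb{T})$ on $\mathcal{O}_{\mathrm{Level}(\mathbb{T})}$ and on $C_0$ by ring maps, written $a\mapsto as$ and $a\mapsto a\varphi$, via $(as)(X)=a(s\cdot X)$ and $(a\varphi)(X)=a(\varphi\cdot X)$. *Class functions and power operations.* For a finite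 group $G$, let $\mathrm{Cl}_n(G,C_0)$ be the ring of $C_0$-valued functions on the set of conjugacy classes of continuous homomorphisms $\alpha\colon\mathbb{L}\to G$. A conjugacy class of continuous homomorphisms $\mathbb{L}\to G\times\Sigma_m$ is a pair consisting of a class $[\alpha\colon\mathbb{L}\to G]$ and an isomorphism class of $\mathbb{L}$-sets with $m$ elements. To the latter we associate the formal sum $\bigoplus_iH_i$ of finite subgroups of $\mathbb{T}$, with one summand $H_i=(\mathbb{L}/\mathbb{L}_i)^*\subset\mathbb{T}$ for each orbit, $\mathbb{L}_i\subset\mathbb{L}$ being the stabilizer of a point of that orbit. Let $\phi$ be a section of the map from endoisogenies of $\mathbb{T}$ to finite subgroups of $\mathbb{T}$ sending an endoisogeny to its kernel; thus $\phi_H$ is an endoisogeny with kernel $H$. Define $P_m^\phi\colon\mathrm{Cl}_n(G,C_0)\to\mathrm{Cl}_n(G\times\Sigma_m,C_0)$ by $$P_m^\phi(f)\bigl([\alpha],\textstyle\bigoplus_iH_i\bigr)=\prod_i f([\alpha\circ\phi_{H_i}^*])\,\phi_{H_i}.$$ The diagonal action of $s\in\operatorname{Aut}(\mathbb{F}/\kappa)$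 on generalized class functions is $(fs)([\alpha])=f([\alpha])\,s$. **Proposition.** For every section $\phi$, every finite group $G$, every $m\ge 0$, every $s\in\operatorname{Aut}(\mathbb{F}/\kappa)$ and every $f\in\mathrm{Cl}_n(G,C_0)$, $$P_m^\phi(f s)=P_m^\phi(f)\,s\quad\text{in }\mathrm{Cl}_n(G\times\Sigma_m,C_0).$$ -/

import Mathlib

open scoped TensorProduct

universe u

noncomputable section

namespace MoravaCharacter

section FormalGroups

variable {R S T : Type*} [CommRing R] [CommRing S] [CommRing T]

/-- The `k`-series `[k]_F(x) = x +_F ⋯ +_F x` of a formal group law. -/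
def nSeries (F : FormalGroup R) : ℕ → PowerSeries R
  | 0 => 0
  | k + 1 => F.toPowerSeries.subst ![nSeries F k, PowerSeries.X]

/-- `F` has height `n` (at the prime `p`): the leading term of `[p]_F(x)` is in degree `p ^ n`. -/
def HasHeight (p n : ℕ) (F : FormalGroup R) : Prop :=
  (nSeries F p).order = ((p ^ n : ℕ) : ℕ∞)

/-- `f` is a homomorphism of formal groups `F → F'`:
`f(0) = 0` and `f(x +_F y) = f(x) +_{F'} f(y)`. -/
structure IsHom (F F' : FormalGroup R) (f : PowerSeries R) : Prop where
  zero : PowerSeries.constantCoeff f = 0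
  add : f.subst F.toPowerSeries = F'.toPowerSeries.subst
    ![f.subst (MvPowerSeries.X 0 : MvPowerSeries (Fin 2) R),
      f.subst (MvPowerSeries.X 1 : MvPowerSeries (Fin 2) R)]

/-- `f` is an isomorphism of formal groups `F → F'`. -/
structure IsIso (F F' : FormalGroup R) (f : PowerSeries R) : Prop extends IsHom F F' f where
  unit : IsUnit (PowerSeries.coeff 1 f)

theorem hasSubst_of_zero {f : PowerSeries R} (h : PowerSeries.constantCoeff f = 0) :
    PowerSeries.HasSubst f := PowerSeries.HasSubst.of_constantCoeff_zero' h

theorem nSeries_zero_coeff (F : FormalGroup R) (k : ℕ) :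
    PowerSeries.constantCoeff (nSeries F k) = 0 := by
  induction k with
  | zero => simp [nSeries]
  | succ k ih =>
    rw [nSeries, PowerSeries.constantCoeff]
    refine MvPowerSeries.constantCoeff_subst_eq_zero
      (MvPowerSeries.hasSubst_of_constantCoeff_zero ?_) ?_ F.zero_constantCoeff
    all_goals
      intro i
      fin_cases i
      · exact ih
      · exact PowerSeries.constantCoeff_X

theorem nSeries_map (F : FormalGroup R) (j : R →+* S) (k : ℕ) :
    nSeries (F.map j) k = PowerSeries.map j (nSeries F k) := by
  induction k with
  | zero => simp [nSeries]
  | succ k ih =>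
    rw [nSeries, nSeries, ih]
    symm
    refine (MvPowerSeries.map_subst (MvPowerSeries.hasSubst_of_constantCoeff_zero ?_) _).trans ?_
    · intro i
      fin_cases i
      · exact nSeries_zero_coeff F k
      · exact PowerSeries.constantCoeff_X
    · congr 1
      funext i
      fin_cases i
      · rfl
      · exact PowerSeries.map_X j

theorem IsHom.map {F F' : FormalGroup R} {f : PowerSeries R} (h : IsHom F F' f) (j : R →+* S) :
    IsHom (F.map j) (F'.map j) (PowerSeries.map j f) := by
  have hf := hasSubst_of_zero h.zero
  refine ⟨by
    rw [← PowerSeries.coeff_zero_eq_constantCoeff_apply, PowerSeries.coeff_map,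
      PowerSeries.coeff_zero_eq_constantCoeff_apply, h.zero, map_zero], ?_⟩
  have e := congrArg (MvPowerSeries.map j) h.add
  rw [PowerSeries.map_subst (PowerSeries.HasSubst.of_constantCoeff_zero F.zero_constantCoeff),
    MvPowerSeries.map_subst] at e
  · rw [FormalGroup.map_toPowerSeries, FormalGroup.map_toPowerSeries, e]
    congr 1
    funext i
    fin_cases i
    · exact (PowerSeries.map_subst (PowerSeries.HasSubst.X (S := R) (0 : Fin 2)) f).trans
        (by rw [MvPowerSeries.map_X]; rfl)
    · exact (PowerSeries.map_subst (PowerSeries.HasSubst.X (S := R) (1 : Fin 2)) f).trans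
        (by rw [MvPowerSeries.map_X]; rfl)
  · refine MvPowerSeries.hasSubst_of_constantCoeff_zero fun i => ?_
    fin_cases i
    · exact PowerSeries.constantCoeff_subst_eq_zero (MvPowerSeries.constantCoeff_X 0) f h.zero
    · exact PowerSeries.constantCoeff_subst_eq_zero (MvPowerSeries.constantCoeff_X 1) f h.zero

theorem IsIso.map {F F' : FormalGroup R} {f : PowerSeries R} (h : IsIso F F' f) (j : R →+* S) :
    IsIso (F.map j) (F'.map j) (PowerSeries.map j f) :=
  ⟨h.toIsHom.map j, by simpa using h.unit.map j⟩

/-- Composition `g ∘ f` of homomorphisms of formal groups. -/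
theorem IsHom.comp {F F' F'' : FormalGroup R} {f g : PowerSeries R}
    (hg : IsHom F' F'' g) (hf : IsHom F F' f) : IsHom F F'' (g.subst f) := by
  have sf := hasSubst_of_zero hf.zero
  have sF : PowerSeries.HasSubst F.toPowerSeries :=
    PowerSeries.HasSubst.of_constantCoeff_zero F.zero_constantCoeff
  have z : ∀ i : Fin 2, MvPowerSeries.constantCoeff
      (f.subst (MvPowerSeries.X i : MvPowerSeries (Fin 2) R)) = 0 := fun i =>
    PowerSeries.constantCoeff_subst_eq_zero (MvPowerSeries.constantCoeff_X i) f hf.zero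
  have sv : MvPowerSeries.HasSubst
      ![f.subst (MvPowerSeries.X 0 : MvPowerSeries (Fin 2) R),
        f.subst (MvPowerSeries.X 1 : MvPowerSeries (Fin 2) R)] := by
    refine MvPowerSeries.hasSubst_of_constantCoeff_zero fun i => ?_
    fin_cases i
    · exact z 0
    · exact z 1
  refine ⟨PowerSeries.constantCoeff_subst_eq_zero hf.zero g hg.zero, ?_⟩
  rw [PowerSeries.subst_comp_subst_apply sf sF, hf.add]
  have e := congrArg (MvPowerSeries.subst
      ![f.subst (MvPowerSeries.X 0 : MvPowerSeries (Fin 2) R),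
        f.subst (MvPowerSeries.X 1 : MvPowerSeries (Fin 2) R)]) hg.add
  have zX : ∀ i : Fin 2, PowerSeries.HasSubst (MvPowerSeries.X i : MvPowerSeries (Fin 2) R) :=
    fun i => PowerSeries.HasSubst.X i
  rw [PowerSeries.subst_def (F'.toPowerSeries), MvPowerSeries.subst_comp_subst_apply
      (PowerSeries.HasSubst.of_constantCoeff_zero F'.zero_constantCoeff).const sv,
    MvPowerSeries.subst_comp_subst_apply _ sv] at e
  · rw [PowerSeries.subst_def]
    refine e.trans ?_
    congr 1
    funext i
    fin_cases i
    · simp only [Fin.zero_eta, Matrix.cons_val_zero]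
      rw [PowerSeries.subst_def _ g, MvPowerSeries.subst_comp_subst_apply (zX 0).const sv,
        PowerSeries.subst_comp_subst_apply sf (zX 0), PowerSeries.subst_def]
      congr 1
      funext _
      exact (MvPowerSeries.subst_X sv 0).trans rfl
    · simp only [Fin.mk_one, Matrix.cons_val_one, Matrix.cons_val_fin_one]
      rw [PowerSeries.subst_def _ g, MvPowerSeries.subst_comp_subst_apply (zX 1).const sv,
        PowerSeries.subst_comp_subst_apply sf (zX 1), PowerSeries.subst_def]
      congr 1
      funext _
      exact (MvPowerSeries.subst_X sv 1).trans rfl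
  · refine MvPowerSeries.hasSubst_of_constantCoeff_zero fun i => ?_
    fin_cases i
    · exact PowerSeries.constantCoeff_subst_eq_zero (MvPowerSeries.constantCoeff_X 0) g hg.zero
    · exact PowerSeries.constantCoeff_subst_eq_zero (MvPowerSeries.constantCoeff_X 1) g hg.zero

theorem coeff_one_subst {f g : PowerSeries R} (hf : PowerSeries.constantCoeff f = 0) :
    PowerSeries.coeff 1 (g.subst f) = PowerSeries.coeff 1 g * PowerSeries.coeff 1 f := by
  rw [PowerSeries.coeff_subst' (hasSubst_of_zero hf), finsum_eq_single _ 1]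
  · simp
  · intro d hd
    obtain rfl | hd2 : d = 0 ∨ 2 ≤ d := by omega
    · simp [PowerSeries.coeff_one]
    · rw [PowerSeries.coeff_of_lt_order 1, smul_zero]
      refine lt_of_lt_of_le ?_ (PowerSeries.le_order_pow_of_constantCoeff_eq_zero d hf)
      exact_mod_cast hd2

theorem IsIso.comp {F F' F'' : FormalGroup R} {f g : PowerSeries R}
    (hg : IsIso F' F'' g) (hf : IsIso F F' f) : IsIso F F'' (g.subst f) :=
  ⟨hg.toIsHom.comp hf.toIsHom, by
    rw [coeff_one_subst hf.zero]; exact hg.unit.mul hf.unit⟩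

theorem map_map (F : FormalGroup R) (j : R →+* S) (k : S →+* T) :
    (F.map j).map k = F.map (k.comp j) := by
  apply FormalGroup.ext
  simp only [FormalGroup.map_toPowerSeries, MvPowerSeries.map_comp, RingHom.comp_apply]

theorem isComm_map {F : FormalGroup R} (h : F.IsComm) (j : R →+* S) : (F.map j).IsComm := by
  constructor
  rw [FormalGroup.map_toPowerSeries]
  have e := congrArg (MvPowerSeries.map j) h.comm
  rw [MvPowerSeries.map_subst MvPowerSeries.HasSubst.X_X] at e
  refine e.trans ?_
  congr 1
  funext i
  fin_cases i <;> simp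

end FormalGroups
section Torus

variable (p : ℕ) [Fact p.Prime] (n : ℕ)

/-- The lattice `ℤ_p ^ n`, with its `p`-adic topology. -/
abbrev Lattice : Type := Fin n → ℤ_[p]

/-- The torus: the Pontryagin dual of the lattice (written additively). -/
abbrev Torus : Type := Additive (PontryaginDual (Multiplicative (Lattice p n)))

variable {p n}

/-- The value of the character `χ` at the lattice point `x`. -/
def pair (χ : Torus p n) (x : Lattice p n) : Circle :=
  (Additive.toMul χ) (Multiplicative.ofAdd x)

theorem pair_add (χ : Torus p n) (x y : Lattice p n) :
    pair χ (x + y) = pair χ x * pair χ y :=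
  map_mul (Additive.toMul χ) (Multiplicative.ofAdd x) (Multiplicative.ofAdd y)

theorem pair_zero (χ : Torus p n) : pair χ 0 = 1 := map_one (Additive.toMul χ)

theorem pair_nsmul (χ : Torus p n) (k : ℕ) (x : Lattice p n) : pair χ (k • x) = pair χ x ^ k :=
  map_pow (Additive.toMul χ) (Multiplicative.ofAdd x) k

theorem add_pair (χ χ' : Torus p n) (x : Lattice p n) :
    pair (χ + χ') x = pair χ x * pair χ' x := rfl

theorem zero_pair (x : Lattice p n) : pair (0 : Torus p n) x = 1 := rfl

theorem nsmul_pair (χ : Torus p n) (k : ℕ) (x : Lattice p n) :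
    pair (k • χ) x = pair χ x ^ k := by
  induction k with
  | zero => simp [zero_pair]
  | succ k ih => rw [succ_nsmul, add_pair, ih, pow_succ]

theorem torus_ext {χ χ' : Torus p n} (h : ∀ x, pair χ x = pair χ' x) : χ = χ' :=
  PontryaginDual.ext (ψ := Additive.toMul χ) (φ := Additive.toMul χ')
    fun a => h (Multiplicative.toAdd a)

theorem continuous_pair (χ : Torus p n) : Continuous (pair χ) :=
  (map_continuous (Additive.toMul χ)).comp continuous_ofAdd

theorem torus_torsion (χ : Torus p n) : ∃ k : ℕ, p ^ k • χ = 0 := by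
  have hV : pair χ ⁻¹' Circle.centeredArc (Real.pi / 2) ∈ nhds (0 : Lattice p n) := by
    refine (continuous_pair χ).continuousAt.preimage_mem_nhds ?_
    rw [pair_zero]
    refine (Circle.isOpen_centeredArc _).mem_nhds ?_
    rw [Circle.mem_centeredArc (by linarith [Real.pi_pos])]
    simp [Real.pi_pos]
  obtain ⟨ε, hε, hb⟩ := Metric.mem_nhds_iff.mp hV
  obtain ⟨k, hk⟩ := PadicInt.exists_pow_neg_lt p hε
  refine ⟨k, torus_ext fun x => ?_⟩
  rw [nsmul_pair, zero_pair]
  refine Circle.eq_one_of_forall_pow_mem_centeredArc_pi_div_two fun m _ => ?_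
  rw [← pow_mul, mul_comm, pow_mul, ← pair_nsmul, ← pair_nsmul]
  refine hb ?_
  rw [mem_ball_zero_iff, pi_norm_lt_iff hε]
  intro i
  refine lt_of_le_of_lt ?_ hk
  have : (p ^ k • m • x) i = (p : ℤ_[p]) ^ k * (m • x i) := by
    simp [nsmul_eq_mul]
  rw [this, norm_mul, PadicInt.norm_p_pow]
  exact mul_le_of_le_one_right (by positivity) (PadicInt.norm_le_one _)

theorem torus_ext_basis {χ χ' : Torus p n}
    (h : ∀ j, pair χ (Pi.single j 1) = pair χ' (Pi.single j 1)) : χ = χ' := by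
  obtain ⟨k, hk⟩ := torus_torsion χ
  obtain ⟨k', hk'⟩ := torus_torsion χ'
  refine torus_ext fun x => ?_
  have key : ∀ j, ∃ (N : ℕ) (y : ℤ_[p]), x j = (N : ℤ_[p]) + (p : ℤ_[p]) ^ (k + k') * y := by
    intro j
    obtain ⟨y, hy⟩ := Ideal.mem_span_singleton.mp ((x j).appr_spec (k + k'))
    exact ⟨(x j).appr (k + k'), y, by rw [← hy]; ring⟩
  choose N y hy using key
  have hx : x = (∑ j, N j • (Pi.single j 1 : Lattice p n)) + p ^ (k + k') • y := by
    funext j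
    simp [hy j, Finset.sum_apply, Pi.single_apply, nsmul_eq_mul]
  have hs : ∀ (ξ : Torus p n) (s : Finset (Fin n)),
      pair ξ (∑ j ∈ s, N j • (Pi.single j 1 : Lattice p n))
        = ∏ j ∈ s, pair ξ (Pi.single j 1) ^ N j := by
    intro ξ s
    induction s using Finset.cons_induction with
    | empty => simpa using pair_zero ξ
    | cons a s ha ih => rw [Finset.sum_cons, Finset.prod_cons, pair_add, pair_nsmul, ih]
  have h1 : pair χ (p ^ (k + k') • y) = 1 := by
    rw [pair_nsmul, pow_add, pow_mul, ← nsmul_pair, hk, zero_pair, one_pow]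
  have h2 : pair χ' (p ^ (k + k') • y) = 1 := by
    rw [pair_nsmul, pow_add, mul_comm, pow_mul, ← nsmul_pair, hk', zero_pair, one_pow]
  rw [hx, pair_add, pair_add, hs, hs, h1, h2]
  simp [h]

theorem finite_torsion {d : ℕ} (hd : 0 < d) : Finite {χ : Torus p n // d • χ = 0} := by
  have : NeZero d := ⟨hd.ne'⟩
  let F : {χ : Torus p n // d • χ = 0} → (Fin n → rootsOfUnity d Circle) := fun χ j =>
    rootsOfUnity.mkOfPowEq (pair χ.1 (Pi.single j 1))
      (by rw [← nsmul_pair, χ.2, zero_pair])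
  have : Finite (rootsOfUnity d Circle) := Finite.of_equiv _ (rootsOfUnityCircleEquiv d).symm.toEquiv
  refine Finite.of_injective F fun χ χ' h => Subtype.ext (torus_ext_basis fun j => ?_)
  have := congrArg (fun z : rootsOfUnity d Circle => ((z : Circleˣ) : Circle)) (congrFun h j)
  simpa [F] using this

/-- The character `x ↦ exp (2πi x_j / p ^ k)` of the lattice. -/
def stdChar (k : ℕ) (j : Fin n) : Torus p n :=
  Additive.ofMul (show Multiplicative (Lattice p n) →ₜ* Circle from
    { toFun := fun x => ZMod.toCircle (PadicInt.toZModPow (p := p) k (Multiplicative.toAdd x j))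
      map_one' := by simp
      map_mul' := fun x y => by simp [AddChar.map_add_eq_mul]
      continuous_toFun := by
        have h : Continuous fun x : ℤ_[p] => (ZMod.toCircle (PadicInt.toZModPow (p := p) k x)) := by
          refine IsLocallyConstant.continuous ((IsLocallyConstant.iff_exists_open _).mpr ?_)
          intro x
          have hp : (0 : ℝ) < (p : ℝ) ^ (-(k : ℤ)) := by
            have : 0 < p := (Fact.out : p.Prime).pos
            positivity
          refine ⟨Metric.ball x ((p : ℝ) ^ (-(k : ℤ))), Metric.isOpen_ball,
            Metric.mem_ball_self hp, fun y hy => ?_⟩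
          have h1 := (PadicInt.norm_le_pow_iff_mem_span_pow (y - x) k).mp
            (by rw [← dist_eq_norm]; exact (Metric.mem_ball.mp hy).le)
          rw [← PadicInt.ker_toZModPow, RingHom.mem_ker, map_sub, sub_eq_zero] at h1
          rw [h1]
        exact h.comp ((continuous_apply j).comp continuous_toAdd) })

theorem pair_stdChar (k : ℕ) (j : Fin n) (x : Lattice p n) :
    pair (stdChar k j) x = ZMod.toCircle (PadicInt.toZModPow (p := p) k (x j)) := rfl

theorem separates {a b : Lattice p n} (h : ∀ χ : Torus p n, pair χ a = pair χ b) : a = b := by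
  funext j
  refine PadicInt.ext_of_toZModPow.mp fun k => ZMod.injective_toCircle ?_
  rw [← pair_stdChar, ← pair_stdChar, h]

theorem exists_toCircle {N : ℕ} [NeZero N] {z : Circle} (hz : z ^ N = 1) :
    ∃ c : ℕ, z = ZMod.toCircle (c : ZMod N) := by
  obtain ⟨c, hc⟩ := (bijective_rootsOfUnityAddChar N).2 (rootsOfUnity.mkOfPowEq z hz)
  refine ⟨c.val, ?_⟩
  have := congrArg (fun z : rootsOfUnity N Circle => ((z : Circleˣ) : Circle)) hc
  simpa using this.symm

/-- Pontryagin duality for the lattice: every character of the torus is evaluation at a point. -/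
theorem exists_eval (ψ : Torus p n →+ Additive Circle) :
    ∃ a : Lattice p n, ∀ χ, pair χ a = (ψ χ).toMul := by
  let C : ℕ → Set (Lattice p n) := fun k =>
    {a | ∀ χ : Torus p n, p ^ k • χ = 0 → pair χ a = (ψ χ).toMul}
  have hanti : ∀ k, C (k + 1) ⊆ C k := fun k a ha χ hχ =>
    ha χ (by rw [pow_succ, mul_comm, mul_smul, hχ, smul_zero])
  have hclosed : ∀ k, IsClosed (C k) := by
    intro k
    have : C k = ⋂ χ : Torus p n, ⋂ _ : p ^ k • χ = 0, {a | pair χ a = (ψ χ).toMul} := by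
      ext a; simp [C]
    rw [this]
    exact isClosed_iInter fun χ => isClosed_iInter fun _ =>
      isClosed_eq (continuous_pair χ) continuous_const
  have hne : ∀ k, (C k).Nonempty := by
    intro k
    have h1 : ∀ j : Fin n, ∃ c : ℕ, (ψ (stdChar k j)).toMul = ZMod.toCircle (c : ZMod (p ^ k)) := by
      intro j
      refine exists_toCircle ?_
      rw [← toMul_nsmul, ← map_nsmul]
      have : p ^ k • (stdChar k j : Torus p n) = 0 := torus_ext fun x => by
        rw [nsmul_pair, pair_stdChar, ← AddChar.map_nsmul_eq_pow, zero_pair]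
        simp [nsmul_eq_mul]
      rw [this, map_zero, toMul_zero]
    choose c hc using h1
    refine ⟨fun j => (c j : ℤ_[p]), fun χ hχ => ?_⟩
    have h2 : ∀ j : Fin n, ∃ d : ℕ,
        pair χ (Pi.single j 1) = ZMod.toCircle (d : ZMod (p ^ k)) := fun j =>
      exists_toCircle (by rw [← nsmul_pair, hχ, zero_pair])
    choose d hd using h2
    have hsum : ∀ (s : Finset (Fin n)) (x : Lattice p n),
        pair (∑ j ∈ s, d j • (stdChar k j : Torus p n)) x = ∏ j ∈ s, pair (stdChar k j) x ^ d j := by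
      intro s x
      induction s using Finset.cons_induction with
      | empty => simpa using zero_pair x
      | cons a s ha ih => rw [Finset.sum_cons, Finset.prod_cons, add_pair, nsmul_pair, ih]
    have hχ' : χ = ∑ j, d j • (stdChar k j : Torus p n) := by
      refine torus_ext_basis fun i => ?_
      rw [hsum, hd, Finset.prod_eq_single i]
      · rw [pair_stdChar, ← AddChar.map_nsmul_eq_pow]
        simp
      · intro j _ hj
        rw [pair_stdChar]
        simp [hj]
      · simp
    rw [hχ', hsum, map_sum, toMul_sum]
    refine Finset.prod_congr rfl fun j _ => ?_
    rw [map_nsmul, toMul_nsmul, hc, pair_stdChar, map_natCast]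
  obtain ⟨a, ha⟩ := IsCompact.nonempty_iInter_of_sequence_nonempty_isCompact_isClosed C hanti hne
    (hclosed 0).isCompact hclosed
  refine ⟨a, fun χ => ?_⟩
  obtain ⟨k, hk⟩ := torus_torsion χ
  exact Set.mem_iInter.mp ha k χ hk

theorem exists_dual (φ : Torus p n →+ Torus p n) (x : Lattice p n) :
    ∃ a : Lattice p n, ∀ χ, pair χ a = pair (φ χ) x :=
  exists_eval
    { toFun := fun χ => Additive.ofMul (pair (φ χ) x)
      map_zero' := by rw [map_zero]; rfl
      map_add' := fun χ χ' => by rw [map_add]; rfl }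

/-- The Pontryagin dual `φ^*` of an endomorphism `φ` of the torus, as a map of the lattice:
`χ (φ^* x) = (φ χ) x`. -/
def dualMap (φ : Torus p n →+ Torus p n) : Lattice p n →+ Lattice p n where
  toFun x := Classical.choose (exists_dual φ x)
  map_zero' := separates fun χ => by
    rw [Classical.choose_spec (exists_dual φ 0) χ, pair_zero, pair_zero]
  map_add' x y := separates fun χ => by
    rw [Classical.choose_spec (exists_dual φ (x + y)) χ, pair_add, pair_add,
      Classical.choose_spec (exists_dual φ x) χ, Classical.choose_spec (exists_dual φ y) χ]

theorem pair_dualMap (φ : Torus p n →+ Torus p n) (χ : Torus p n) (x : Lattice p n) :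
    pair χ (dualMap φ x) = pair (φ χ) x :=
  Classical.choose_spec (exists_dual φ x) χ

theorem continuous_dualMap (φ : Torus p n →+ Torus p n) : Continuous (dualMap φ) := by
  let ev : Lattice p n → (Torus p n → Circle) := fun x χ => pair χ x
  have hev : Continuous ev := continuous_pi fun χ => continuous_pair χ
  have hemb : Topology.IsClosedEmbedding ev :=
    hev.isClosedEmbedding fun a b h => separates fun χ => congrFun h χ
  rw [hemb.isInducing.continuous_iff]
  refine continuous_pi fun χ => ?_
  exact (continuous_pair (φ χ)).congr fun x => (pair_dualMap φ χ x).symm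

end Torus

section Moduli

/-- A complete local ring `(R, 𝔪)`: a local ring with `R = lim R / 𝔪 ^ k`. -/
structure CompleteLocalRing : Type (u + 1) where
  carrier : Type u
  [commRing : CommRing carrier]
  [isLocalRing : IsLocalRing carrier]
  [isAdicComplete : IsAdicComplete (IsLocalRing.maximalIdeal carrier) carrier]

instance : CoeSort CompleteLocalRing.{u} (Type u) := ⟨CompleteLocalRing.carrier⟩

attribute [instance] CompleteLocalRing.commRing CompleteLocalRing.isLocalRing
  CompleteLocalRing.isAdicComplete

section Values

variable {R S : Type*} [CommRing R] [IsLocalRing R] [CommRing S] [IsLocalRing S]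

/-- `b = f(a)`: the series `∑ f_i a ^ i` converges to `b` in the `𝔪`-adic topology, for `a ∈ 𝔪`. -/
def HasValue (f : PowerSeries R) (a b : R) : Prop :=
  ∀ N : ℕ, b - ∑ i ∈ Finset.range N, PowerSeries.coeff i f * a ^ i
    ∈ IsLocalRing.maximalIdeal R ^ N

/-- `c = a +_F b`: the series `∑ F_{ij} a ^ i b ^ j` converges to `c` in the `𝔪`-adic topology,
for `a, b ∈ 𝔪`. -/
def HasSumValue (F : FormalGroup R) (a b c : R) : Prop :=
  ∀ N : ℕ, c - ∑ i ∈ Finset.range N, ∑ j ∈ Finset.range N,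
      MvPowerSeries.coeff (Finsupp.single 0 i + Finsupp.single 1 j) F.toPowerSeries * a ^ i * b ^ j
    ∈ IsLocalRing.maximalIdeal R ^ N

theorem map_mem_pow (j : R →+* S) [IsLocalHom j] {N : ℕ} {x : R}
    (hx : x ∈ IsLocalRing.maximalIdeal R ^ N) : j x ∈ IsLocalRing.maximalIdeal S ^ N := by
  have h := Ideal.mem_map_of_mem j hx
  rw [Ideal.map_pow] at h
  exact Ideal.pow_right_mono (IsLocalRing.map_maximalIdeal_le j) N h

theorem HasValue.map {f : PowerSeries R} {a b : R} (h : HasValue f a b) (j : R →+* S)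
    [IsLocalHom j] : HasValue (PowerSeries.map j f) (j a) (j b) := fun N => by
  simpa using map_mem_pow j (h N)

theorem HasSumValue.map {F : FormalGroup R} {a b c : R} (h : HasSumValue F a b c) (j : R →+* S)
    [IsLocalHom j] : HasSumValue (F.map j) (j a) (j b) (j c) := fun N => by
  simpa using map_mem_pow j (h N)

end Values

variable {κ : Type u} [Field κ]

open IsLocalRing (ResidueField residue maximalIdeal)

/-- The group `Aut(𝔽 / κ)` of automorphisms of `𝔽` over `κ` (the Morava stabilizer group). -/
abbrev Stabilizer (𝔽 : FormalGroup κ) : Type u := {s : PowerSeries κ // IsIso 𝔽 𝔽 s}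

/-- A deformation `(𝔾, i, τ)` of the formal group `𝔽 / κ` to the complete local ring `R`: a formal
group `𝔾` over `R`, a map of fields `i : κ → R / 𝔪` and an isomorphism `τ : π^* 𝔾 ≅ i^* 𝔽`. -/
structure Deformation (𝔽 : FormalGroup κ) (R : CompleteLocalRing.{u}) where
  G : FormalGroup R
  isComm : G.IsComm
  i : κ →+* ResidueField R
  τ : PowerSeries (ResidueField R)
  τ_iso : IsIso (G.map (residue R)) (𝔽.map i) τ

/-- A level structure (in the sense of Drinfeld) `l : A → 𝔾` on a formal group over `R`, for the
prime `p`: a homomorphism from `A` to the group `𝔾(R) = (𝔪, +_𝔾)` such that the divisor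
`∑_{a ∈ A[p]} [l(a)]` is contained in the subgroup scheme `𝔾[p]`. (For a finite abelian `p`-group
`A` and `𝔾` of height `n` this makes the divisor `∑_{a ∈ A} [l(a)]` a subgroup scheme, and it forces
the rank of `A` to be at most `n`.) -/
structure IsLevelStructure (p : ℕ) {A : Type*} [AddCommGroup A] {R : Type*} [CommRing R]
    [IsLocalRing R] (G : FormalGroup R) (l : A → R) : Prop where
  mem : ∀ a, l a ∈ maximalIdeal R
  add : ∀ a b, HasSumValue G (l a) (l b) (l (a + b))
  level : (∏ᶠ a : {a : A // p • a = 0}, (PowerSeries.X - PowerSeries.C (l a))) ∣ nSeries G p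

/-- A deformation `(l : A → 𝔾, i, τ)` of `𝔽 / κ` to `R` equipped with a level structure. -/
@[ext]
structure LevelDeformation (p : ℕ) (𝔽 : FormalGroup κ) (A : Type*) [AddCommGroup A]
    (R : CompleteLocalRing.{u}) extends Deformation 𝔽 R where
  l : A → R
  isLevel : IsLevelStructure p G l

namespace LevelDeformation

variable {p : ℕ} {𝔽 : FormalGroup κ} {A : Type*} [AddCommGroup A]
  {A' : Type*} [AddCommGroup A'] {R S : CompleteLocalRing.{u}}

/-- A `⋆`-isomorphism of deformations with level structure: an isomorphism `δ : 𝔾 ≅ 𝔾'` compatible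
with `τ`, `τ'` and with the level structures (and `i = i'`). -/
structure IsStarIso (X Y : LevelDeformation p 𝔽 A R) (δ : PowerSeries R) : Prop where
  iso : IsIso X.G Y.G δ
  i_eq : X.i = Y.i
  τ_eq : Y.τ.subst (PowerSeries.map (residue R) δ) = X.τ
  l_eq : ∀ a, HasValue δ (X.l a) (Y.l a)

/-- Base change of a deformation with level structure along a local homomorphism `j : R → S`. -/
def baseChange (X : LevelDeformation p 𝔽 A R) [Finite A] (j : R →+* S) [IsLocalHom j] :
    LevelDeformation p 𝔽 A S where
  G := X.G.map j
  isComm := isComm_map X.isComm j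
  i := (ResidueField.map j).comp X.i
  τ := PowerSeries.map (ResidueField.map j) X.τ
  τ_iso := by
    have h := X.τ_iso.map (ResidueField.map j)
    have e : (ResidueField.map j).comp (residue R) = (residue S).comp j := RingHom.ext fun x => rfl
    rw [map_map, map_map, e, ← map_map] at h
    exact h
  l := fun a => j (X.l a)
  isLevel :=
    { mem := fun a => by
        have h := map_mem_pow j (N := 1) (by simpa using X.isLevel.mem a)
        simpa using h
      add := fun a b => (X.isLevel.add a b).map j
      level := by
        have := Fintype.ofFinite {a : A // p • a = 0}
        have h := map_dvd (PowerSeries.map j) X.isLevel.level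
        rw [finprod_eq_prod_of_fintype, map_prod, ← nSeries_map] at h
        rw [finprod_eq_prod_of_fintype]
        simpa using h }

/-- Restriction of a level structure on `A` along an injection `f : A' → A`. -/
def restrict (X : LevelDeformation p 𝔽 A R) [Finite A] (f : A' →+ A)
    (hf : Function.Injective f) : LevelDeformation p 𝔽 A' R where
  toDeformation := X.toDeformation
  l := fun a => X.l (f a)
  isLevel :=
    { mem := fun a => X.isLevel.mem (f a)
      add := fun a b => by rw [map_add]; exact X.isLevel.add _ _
      level := by
        have : Finite A' := Finite.of_injective f hf
        have := Fintype.ofFinite {a : A // p • a = 0}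
        have := Fintype.ofFinite {a : A' // p • a = 0}
        refine dvd_trans ?_ X.isLevel.level
        rw [finprod_eq_prod_of_fintype, finprod_eq_prod_of_fintype]
        let g : {a : A' // p • a = 0} ↪ {a : A // p • a = 0} :=
          ⟨fun a => ⟨f a, by rw [← map_nsmul, a.2, map_zero]⟩, fun a b h =>
            Subtype.ext (hf (congrArg Subtype.val h))⟩
        have e : (∏ a : {a : A' // p • a = 0},
            (PowerSeries.X - PowerSeries.C (X.l (f a)) : PowerSeries R))
            = ∏ a ∈ Finset.univ.map g, (PowerSeries.X - PowerSeries.C (X.l a)) := by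
          rw [Finset.prod_map]; rfl
        rw [e]
        exact Finset.prod_dvd_prod_of_subset _ _ _ (Finset.subset_univ _) }

/-- The action of an automorphism `s` of `𝔽` over `κ` on deformations with level structure:
`s · (l, i, τ) = (l, i, (i^* s) τ)`. -/
def stab (s : Stabilizer 𝔽) (X : LevelDeformation p 𝔽 A R) :
    LevelDeformation p 𝔽 A R where
  G := X.G
  isComm := X.isComm
  i := X.i
  τ := (PowerSeries.map X.i s.1).subst X.τ
  τ_iso := (s.2.map X.i).comp X.τ_iso
  l := X.l
  isLevel := X.isLevel

theorem stab_baseChange (X : LevelDeformation p 𝔽 A R) (s : Stabilizer 𝔽)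
    [Finite A] (j : R →+* S) [IsLocalHom j] :
    (X.baseChange j).stab s = (X.stab s).baseChange j := by
  have e := PowerSeries.map_subst (hasSubst_of_zero X.τ_iso.zero) (h := ResidueField.map j)
    (PowerSeries.map X.i s.1)
  rw [← RingHom.comp_apply (PowerSeries.map (ResidueField.map j)), ← PowerSeries.map_comp] at e
  exact LevelDeformation.ext rfl rfl e.symm rfl

end LevelDeformation

/-- The ring of functions on the moduli problem of deformations of `𝔽` with level structure
`l : A → 𝔾`, that is, the ring of natural transformations from this moduli problem to the affine
line: families of functions, one for each complete local ring `R`, which take deformations with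
level structure over `R` to elements of `R`, are constant on `⋆`-isomorphism classes and commute
with base change. (By the Yoneda lemma this is the ring which corepresents the moduli problem.) -/
def levelRing (p : ℕ) (𝔽 : FormalGroup κ) (A : Type) [AddCommGroup A] [Finite A] :
    Subring ((R : CompleteLocalRing.{u}) → LevelDeformation p 𝔽 A R → R) where
  carrier := {f |
    (∀ (R : CompleteLocalRing.{u}) (X Y : LevelDeformation p 𝔽 A R) (δ : PowerSeries R),
      LevelDeformation.IsStarIso X Y δ → f R X = f R Y) ∧
    ∀ (R S : CompleteLocalRing.{u}) (j : R →+* S) [IsLocalHom j] (X : LevelDeformation p 𝔽 A R),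
      f S (X.baseChange j) = j (f R X)}
  mul_mem' := fun {f g} hf hg => ⟨fun R X Y δ h => by
      simp only [Pi.mul_apply, hf.1 R X Y δ h, hg.1 R X Y δ h],
    fun R S j _ X => by simp only [Pi.mul_apply, hf.2, hg.2, map_mul]⟩
  add_mem' := fun {f g} hf hg => ⟨fun R X Y δ h => by
      simp only [Pi.add_apply, hf.1 R X Y δ h, hg.1 R X Y δ h],
    fun R S j _ X => by simp only [Pi.add_apply, hf.2, hg.2, map_add]⟩
  one_mem' := ⟨fun _ _ _ _ _ => rfl, fun _ _ j _ _ => (map_one j).symm⟩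
  zero_mem' := ⟨fun _ _ _ _ _ => rfl, fun _ _ j _ _ => (map_zero j).symm⟩
  neg_mem' := fun {f} hf => ⟨fun R _ _ _ h => by simp only [Pi.neg_apply, hf.1 R _ _ _ h],
    fun R S j _ X => by simp only [Pi.neg_apply, hf.2, map_neg]⟩

variable {p : ℕ} {𝔽 : FormalGroup κ} {A A' : Type} [AddCommGroup A] [Finite A]
  [AddCommGroup A'] [Finite A']

/-- The map on rings of functions induced by restriction of level structures along `f : A' → A`. -/
def levelRingRestrict (f : A' →+ A) (hf : Function.Injective f) :
    levelRing p 𝔽 A' →+* levelRing p 𝔽 A where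
  toFun a := ⟨fun R X => a.1 R (X.restrict f hf),
    fun R _ _ δ h => a.2.1 R _ _ δ ⟨h.iso, h.i_eq, h.τ_eq, fun x => h.l_eq (f x)⟩,
    fun R S j _ X => a.2.2 R S j (X.restrict f hf)⟩
  map_one' := rfl
  map_zero' := rfl
  map_mul' _ _ := rfl
  map_add' _ _ := rfl

/-- The right action of `s ∈ Aut(𝔽 / κ)` on the ring of functions: `(a s)(X) = a (s · X)`. -/
def levelRingStab (s : Stabilizer 𝔽) : levelRing p 𝔽 A →+* levelRing p 𝔽 A where
  toFun a := ⟨fun R X => a.1 R (X.stab s),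
    fun R X Y δ h => a.2.1 R _ _ δ ⟨h.iso, h.i_eq, by
      have hδ : PowerSeries.constantCoeff (PowerSeries.map (residue R) δ) = 0 :=
        (h.iso.map (residue R)).zero
      have := PowerSeries.subst_comp_subst_apply (hasSubst_of_zero Y.τ_iso.zero)
        (hasSubst_of_zero hδ) (PowerSeries.map Y.i s.1)
      simp only [LevelDeformation.stab]
      rw [this, h.τ_eq, h.i_eq], h.l_eq⟩,
    fun R S j _ X => (congrArg (a.1 S) (X.stab_baseChange s j)).trans
      (a.2.2 R S j (X.stab s))⟩
  map_one' := rfl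
  map_zero' := rfl
  map_mul' _ _ := rfl
  map_add' _ _ := rfl

end Moduli

section Drinfeld

variable (p : ℕ) [Fact p.Prime] (n : ℕ)

/-- The `p ^ k`-torsion subgroup of the torus. -/
def torsion (k : ℕ) : AddSubgroup (Torus p n) where
  carrier := {χ | p ^ k • χ = 0}
  zero_mem' := smul_zero _
  add_mem' := fun {χ χ'} h h' => by
    have h : p ^ k • χ = 0 := h
    have h' : p ^ k • χ' = 0 := h'
    change p ^ k • (χ + χ') = 0
    rw [smul_add, h, h', add_zero]
  neg_mem' := fun {χ} h => by
    have h : p ^ k • χ = 0 := h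
    change p ^ k • (-χ) = 0
    rw [smul_neg, h, neg_zero]

instance (k : ℕ) : Finite (torsion p n k) :=
  finite_torsion (p := p) (n := n) (pow_pos (Fact.out : p.Prime).pos k)

variable {p n} in
theorem torsion_mono {k j : ℕ} (h : k ≤ j) : torsion p n k ≤ torsion p n j := by
  intro χ hχ
  have hχ : p ^ k • χ = 0 := hχ
  change p ^ j • χ = 0
  rw [← Nat.sub_add_cancel h, pow_add, mul_smul, hχ, smul_zero]

variable {κ : Type u} [Field κ] (𝔽 : FormalGroup κ)

/-- The ring of functions on deformations with level structure `𝕋[p ^ k] → 𝔾`. -/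
abbrev finiteLevelRing (k : ℕ) : Type (u + 1) := levelRing p 𝔽 (torsion p n k)

/-- The transition maps, given by restriction of level structures from `𝕋[p ^ j]` to
`𝕋[p ^ k]`. -/
def transition (k j : ℕ) (h : k ≤ j) : finiteLevelRing p n 𝔽 k →+* finiteLevelRing p n 𝔽 j :=
  levelRingRestrict (AddSubgroup.inclusion (torsion_mono h))
    (AddSubgroup.inclusion_injective (torsion_mono h))

/-- The Drinfeld ring: the colimit over `k` of the rings of functions on deformations with level
structure `𝕋[p ^ k] → 𝔾`. -/
abbrev DrinfeldRing : Type (u + 1) :=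
  Ring.DirectLimit (finiteLevelRing p n 𝔽) fun k j h => transition p n 𝔽 k j h

/-- The rationalized Drinfeld ring. -/
abbrev C0 : Type (u + 1) := ℚ ⊗[ℤ] DrinfeldRing p n 𝔽

/-- The endomorphism of the rationalized Drinfeld ring induced by one of the Drinfeld ring. -/
def rationalize {p : ℕ} [Fact p.Prime] {n : ℕ} {𝔽 : FormalGroup κ}
    (e : DrinfeldRing p n 𝔽 →+* DrinfeldRing p n 𝔽) :
    C0 p n 𝔽 →+* C0 p n 𝔽 :=
  (Algebra.TensorProduct.map (AlgHom.id ℤ ℚ) e.toIntAlgHom).toRingHom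

variable {p n 𝔽}

/-- The action of the stabilizer group on the Drinfeld ring. -/
def drinfeldStab (s : Stabilizer 𝔽) : DrinfeldRing p n 𝔽 →+* DrinfeldRing p n 𝔽 :=
  Ring.DirectLimit.map (fun _ => levelRingStab s) fun _ _ _ => rfl

/-- The action of the stabilizer group on the rationalized Drinfeld ring. -/
def stabC0 (s : Stabilizer 𝔽) : C0 p n 𝔽 →+* C0 p n 𝔽 := rationalize (drinfeldStab s)

variable (p n) in
/-- The endoisogenies of the torus: endomorphisms with finite kernel. -/
structure Isog where
  toHom : Torus p n →+ Torus p n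
  finite_ker : Finite toHom.ker

/-- `Y = (l' : 𝕋[p ^ k] → 𝔾', i', τ')` is the result `((l / H) ψ_H⁻¹, i σ ^ r, τ / H)` of letting the
isogeny `φ` with kernel `H` of order `p ^ r` act on `X = (l : 𝕋[p ^ j] → 𝔾, i, τ)`. Here
`q : 𝔾 → 𝔾'` is the quotient map of `𝔾` by the subgroup `l(H)`, that is, a homomorphism of formal
groups with kernel the divisor `∑_{h ∈ H} [l(h)]`; the level structure `l' = (l / H) ψ_H⁻¹` is
determined by `l'(φ t) = q(l(t))`; and `τ' = τ / H` is determined by `τ' π^*q = (i^*Frob ^ r) τ`,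
where the relative Frobenius `Frob ^ r : 𝔽 → (σ ^ r)^* 𝔽` is given by the series `x ^ (p ^ r)`. -/
def IsIsogQuotient [CharP κ p] (φ : Isog p n) {k j : ℕ}
    (hφ : ∀ t, φ.toHom t ∈ torsion p n k → t ∈ torsion p n j) {R : CompleteLocalRing.{u}}
    (X : LevelDeformation p 𝔽 (torsion p n j) R) (Y : LevelDeformation p 𝔽 (torsion p n k) R) :
    Prop :=
  ∃ (r : ℕ) (q : PowerSeries R),
    Nat.card φ.toHom.ker = p ^ r ∧
    IsHom X.G Y.G q ∧
    Associated q (∏ᶠ h : φ.toHom.ker, (PowerSeries.X - PowerSeries.C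
      (X.l ⟨h, hφ h (by rw [h.2]; exact zero_mem _)⟩))) ∧
    (∀ t (ht : φ.toHom t ∈ torsion p n k), HasValue q (X.l ⟨t, hφ t ht⟩) (Y.l ⟨φ.toHom t, ht⟩)) ∧
    Y.i = X.i.comp (iterateFrobenius κ p r) ∧
    Y.τ.subst (PowerSeries.map (IsLocalRing.residue R) q)
      = (PowerSeries.X ^ p ^ r : PowerSeries (IsLocalRing.ResidueField R)).subst X.τ

/-- `b = a φ` in the Drinfeld ring: for `a` represented by a function on deformations with level
structure `𝕋[p ^ k] → 𝔾` and `b` by one on deformations with level structure `𝕋[p ^ j] → 𝔾`, we have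
`b(X) = a(φ · X)`. -/
def IsIsogPullback [CharP κ p] (φ : Isog p n) (a b : DrinfeldRing p n 𝔽) : Prop :=
  ∃ (k j : ℕ) (hφ : ∀ t, φ.toHom t ∈ torsion p n k → t ∈ torsion p n j)
    (f : finiteLevelRing p n 𝔽 k) (g : finiteLevelRing p n 𝔽 j),
    a = Ring.DirectLimit.of _ _ k f ∧ b = Ring.DirectLimit.of _ _ j g ∧
    ∀ (R : CompleteLocalRing.{u}) (X : LevelDeformation p 𝔽 (torsion p n j) R)
      (Y : LevelDeformation p 𝔽 (torsion p n k) R), IsIsogQuotient φ hφ X Y → g.1 R X = f.1 R Y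

open Classical in
/-- The right action of an isogeny `φ` on the Drinfeld ring: the unique ring endomorphism which is
given by `(a φ)(X) = a(φ · X)` on deformations with level structure. (It exists since the quotient
of a deformation with level structure by a finite subgroup `H` of the torus exists, and it is unique
since this quotient is unique up to `⋆`-isomorphism.) -/
def drinfeldIsog [CharP κ p] (φ : Isog p n) : DrinfeldRing p n 𝔽 →+* DrinfeldRing p n 𝔽 :=
  if h : ∃! e : DrinfeldRing p n 𝔽 →+* DrinfeldRing p n 𝔽, ∀ a, IsIsogPullback φ a (e a)
  then h.choose else RingHom.id _

/-- The right action of an isogeny on the rationalized Drinfeld ring. -/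
def isogC0 [CharP κ p] (φ : Isog p n) : C0 p n 𝔽 →+* C0 p n 𝔽 := rationalize (drinfeldIsog φ)

end Drinfeld

section ClassFunctions

variable (p : ℕ) [Fact p.Prime] (n : ℕ)

/-- Continuous homomorphisms from the lattice to a (finite) discrete group `G`. -/
structure LatticeHom (G : Type*) [Group G] where
  toHom : Multiplicative (Lattice p n) →* G
  continuous' : IsLocallyConstant toHom

variable {p n} {G G' : Type*} [Group G] [Group G']

/-- The composite `α ∘ φ^*`, for `φ^*` the Pontryagin dual of an isogeny `φ` of the torus. -/
def LatticeHom.compDual (α : LatticeHom p n G) (φ : Isog p n) : LatticeHom p n G where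
  toHom := α.toHom.comp (AddMonoidHom.toMultiplicative (dualMap φ.toHom))
  continuous' := α.continuous'.comp_continuous (f := AddMonoidHom.toMultiplicative (dualMap φ.toHom))
    (continuous_ofAdd.comp ((continuous_dualMap φ.toHom).comp continuous_toAdd))

/-- The composite of a homomorphism `α` from the lattice with a homomorphism of groups. -/
def LatticeHom.map (γ : G →* G') (α : LatticeHom p n G) : LatticeHom p n G' where
  toHom := γ.comp α.toHom
  continuous' := α.continuous'.comp γ

variable (p n G) in
/-- The conjugation relation on homomorphisms from the lattice to `G`. -/
instance conjSetoid : Setoid (LatticeHom p n G) where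
  r α β := ∃ g : G, ∀ x, β.toHom x = g * α.toHom x * g⁻¹
  iseqv :=
    { refl := fun α => ⟨1, fun x => by simp⟩
      symm := fun {α β} ⟨g, hg⟩ => ⟨g⁻¹, fun x => by rw [hg]; group⟩
      trans := fun {α β γ} ⟨g, hg⟩ ⟨h, hh⟩ => ⟨h * g, fun x => by rw [hh, hg]; group⟩ }

variable (p n) in
/-- The ring `Cl_n(G, C)` of generalized class functions: functions on conjugacy classes of
continuous homomorphisms from the lattice to `G`, with values in `C`. -/
abbrev ClassFunction (G : Type*) [Group G] (C : Type*) : Type _ :=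
  Quotient (conjSetoid p n G) → C

variable (p n) in
/-- The finite subgroups of the torus. -/
abbrev FiniteSubgroup : Type := {H : AddSubgroup (Torus p n) // Finite H}

variable (p n) in
/-- The sections of the map from isogenies of the torus to finite subgroups which sends an isogeny
to its kernel. -/
abbrev IsogSection : Type := {φ : FiniteSubgroup p n → Isog p n // ∀ H, (φ H).toHom.ker = H.1}

variable {m : ℕ}

/-- The subgroup `(𝕃 / 𝕃_i)^*` of the torus, where `𝕃_i` is the stabilizer of the point `i` under
the action of the lattice `𝕃` given by `ρ`: the characters which are trivial on `𝕃_i`. -/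
def stabilizerDual (ρ : LatticeHom p n (Equiv.Perm (Fin m))) (i : Fin m) : FiniteSubgroup p n :=
  ⟨{  carrier := {χ | ∀ x, ρ.toHom (Multiplicative.ofAdd x) i = i → pair χ x = 1}
      zero_mem' := fun x _ => zero_pair x
      add_mem' := fun {χ χ'} h h' x hx => by rw [add_pair, h x hx, h' x hx, one_mul]
      neg_mem' := fun {χ} h x hx => by
        have := add_pair χ (-χ) x
        rw [add_neg_cancel, zero_pair, h x hx, one_mul] at this
        exact this.symm },
    by
      have := finite_torsion (p := p) (n := n) (Nat.factorial_pos m)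
      refine Finite.of_injective (β := {χ : Torus p n // m.factorial • χ = 0})
        (fun χ => ⟨χ.1, torus_ext fun x => ?_⟩)
        fun χ χ' h => Subtype.ext (congrArg (fun z => z.1) h)
      rw [nsmul_pair, ← pair_nsmul, zero_pair]
      refine χ.2 _ ?_
      have hc : ρ.toHom (Multiplicative.ofAdd x) ^ m.factorial = 1 := by
        have := pow_card_eq_one' (x := ρ.toHom (Multiplicative.ofAdd x))
        rwa [Nat.card_perm, Nat.card_eq_fintype_card, Fintype.card_fin] at this
      rw [ofAdd_nsmul, map_pow, hc]
      rfl⟩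

/-- The orbit relation on `{1, …, m}` of the action of the lattice given by `ρ`. -/
def orbitSetoid (ρ : LatticeHom p n (Equiv.Perm (Fin m))) : Setoid (Fin m) where
  r i j := ∃ x, ρ.toHom x i = j
  iseqv :=
    { refl := fun i => ⟨1, by simp⟩
      symm := fun {i j} ⟨x, hx⟩ => ⟨x⁻¹, by rw [map_inv, ← hx]; simp⟩
      trans := fun {i j l} ⟨x, hx⟩ ⟨y, hy⟩ => ⟨y * x, by rw [map_mul, ← hy, ← hx]; rfl⟩ }

theorem stabilizerDual_conj (ρ ρ' : LatticeHom p n (Equiv.Perm (Fin m))) (s : Equiv.Perm (Fin m))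
    (h : ∀ x, ρ'.toHom x = s * ρ.toHom x * s⁻¹) (i : Fin m) :
    stabilizerDual ρ' (s i) = stabilizerDual ρ i := by
  have hs : s⁻¹ (s i) = i := s.symm_apply_apply i
  apply Subtype.ext
  ext χ
  simp only [stabilizerDual, AddSubgroup.mem_mk, AddSubmonoid.mem_mk, AddSubsemigroup.mem_mk,
    Set.mem_ofPred_eq, h, Equiv.Perm.mul_apply, hs, EmbeddingLike.apply_eq_iff_eq]

theorem stabilizerDual_orbit (ρ : LatticeHom p n (Equiv.Perm (Fin m))) (i j : Fin m)
    (h : (orbitSetoid ρ).r i j) : stabilizerDual ρ i = stabilizerDual ρ j := by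
  obtain ⟨x, rfl⟩ := h
  refine (stabilizerDual_conj ρ ρ (ρ.toHom x) (fun y => ?_) i).symm
  rw [← map_mul, ← map_inv, ← map_mul, mul_inv_cancel_comm]

open Classical in
/-- The formal sum `⊕_i H_i` of finite subgroups of the torus associated to a homomorphism
`ρ : 𝕃 → Σ_m`: there is one summand `H_i = (𝕃 / 𝕃_i)^*` for each orbit of the action of `𝕃` on
`{1, …, m}`, where `𝕃_i` is the stabilizer of any point of the orbit. -/
def orbitSum (ρ : LatticeHom p n (Equiv.Perm (Fin m))) : Multiset (FiniteSubgroup p n) :=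
  (Finset.univ : Finset (Quotient (orbitSetoid ρ))).val.map
    (Quotient.lift (stabilizerDual ρ) (stabilizerDual_orbit ρ))

theorem orbitSum_conj (ρ ρ' : LatticeHom p n (Equiv.Perm (Fin m))) (s : Equiv.Perm (Fin m))
    (h : ∀ x, ρ'.toHom x = s * ρ.toHom x * s⁻¹) : orbitSum ρ = orbitSum ρ' := by
  classical
  let e : Quotient (orbitSetoid ρ) ≃ Quotient (orbitSetoid ρ') :=
    Quotient.congr s fun i j => by
      change (∃ x, ρ.toHom x i = j) ↔ ∃ x, ρ'.toHom x (s i) = s j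
      simp [h]
  unfold orbitSum
  rw [← Multiset.map_univ_val_equiv e, Multiset.map_map]
  refine Multiset.map_congr rfl fun o _ => ?_
  induction o using Quotient.inductionOn with
  | h i => exact (stabilizerDual_conj ρ ρ' s h i).symm

variable {κ : Type u} [Field κ] {𝔽 : FormalGroup κ}

/-- The power operation `P_m^φ : Cl_n(G, C0) → Cl_n(G × Σ_m, C0)`,
`P_m^φ(f)([α], ⊕_i H_i) = ∏_i f([α φ_{H_i}^*]) φ_{H_i}`. -/
def powerOp [CharP κ p] (φ : IsogSection p n) (m : ℕ) (f : ClassFunction p n G (C0 p n 𝔽)) :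
    ClassFunction p n (G × Equiv.Perm (Fin m)) (C0 p n 𝔽) :=
  Quotient.lift
    (fun β : LatticeHom p n (G × Equiv.Perm (Fin m)) =>
      ((orbitSum (β.map (MonoidHom.snd G _))).map fun H =>
        isogC0 (φ.1 H) (f ⟦(β.map (MonoidHom.fst G _)).compDual (φ.1 H)⟧)).prod)
    (by
      rintro β β' ⟨g, hg⟩
      have h1 : ∀ ψ : Isog p n, (⟦(β.map (MonoidHom.fst G _)).compDual ψ⟧ :
          Quotient (conjSetoid p n G)) = ⟦(β'.map (MonoidHom.fst G _)).compDual ψ⟧ := fun ψ =>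
        Quotient.sound ⟨g.1, fun x => congrArg Prod.fst
          (hg (AddMonoidHom.toMultiplicative (dualMap ψ.toHom) x))⟩
      have h2 : orbitSum (β.map (MonoidHom.snd G _)) = orbitSum (β'.map (MonoidHom.snd G _)) :=
        orbitSum_conj _ _ g.2 fun x => congrArg Prod.snd (hg x)
      simp only [h1, h2])

/-- The diagonal action of `s ∈ Aut(𝔽 / κ)` on `Cl_n(G, C0)`, that is, on the values. -/
def stabClass (s : Stabilizer 𝔽) (f : ClassFunction p n G (C0 p n 𝔽)) :
    ClassFunction p n G (C0 p n 𝔽) :=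
  fun c => stabC0 s (f c)

end ClassFunctions

end MoravaCharacter

end

/-! The theorem reduces to one commutation: for every isogeny `φ` of the torus and every
automorphism `s` of `𝔽`, the two actions on `C0` commute. Given this, the value of either side at a
class is a product over the same multiset of subgroups `H`; `s` acts only on values and by a ring
map, so it passes through the product, and then past each `φ_H`.

On deformations the commutation is naturality of Frobenius. Both actions alter `τ`, and `s` alters
nothing else, so one quotient map `q : 𝔾 → 𝔾'` serves for `X` and for `s · X`. The new
trivialization is characterized by `τ' π^*q = Frob ^ r τ`, and `Frob ^ r s = (σ ^ r)^*s Frob ^ r`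
turns this into the same relation for `s τ` and `(σ ^ r)^*s τ'`. This is exactly how `s` acts on the
quotient, whose structure map is `i σ ^ r`. See `subst_map_comp_iterateFrobenius` and
`IsIsogQuotient.stab`.

On the Drinfeld ring the action of `φ` is specified by unique existence, with the identity as
default value. Conjugating the specified endomorphism by `s` yields one with the same characterizing
property, so uniqueness makes the two equal; the default commutes with everything. Hence
`drinfeldIsog_drinfeldStab` needs no construction of quotients, only the inverse of `s`, supplied by
`IsIso.inv`. -/

namespace MoravaCharacter

open IsLocalRing (ResidueField residue maximalIdeal)

/-! ### Inverses of isomorphisms of formal groups. -/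

section Inverse

variable {R : Type*} [CommRing R]

/-- The compositional inverse of an isomorphism of formal groups is an isomorphism. -/
theorem IsIso.inv {F F' : FormalGroup R} {f : PowerSeries R} (h : IsIso F F' f) :
    IsIso F' F (f.substInvOfIsUnit h.unit) := by
  set t := f.substInvOfIsUnit h.unit with ht
  have zt : PowerSeries.constantCoeff t = 0 := PowerSeries.constantCoeff_substInvOfIsUnit f h.unit
  have hft : f.subst t = PowerSeries.X := PowerSeries.subst_substInvOfIsUnit_right f h.zero h.unit
  have htf : t.subst f = PowerSeries.X := PowerSeries.subst_substInvOfIsUnit_left f h.zero h.unit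
  have st := hasSubst_of_zero zt
  have sf := hasSubst_of_zero h.zero
  have zX : ∀ i : Fin 2, PowerSeries.HasSubst (MvPowerSeries.X i : MvPowerSeries (Fin 2) R) :=
    fun i => PowerSeries.HasSubst.X i
  have hz : ∀ (g : PowerSeries R), PowerSeries.constantCoeff g = 0 → ∀ i : Fin 2,
      MvPowerSeries.constantCoeff (g.subst (MvPowerSeries.X i : MvPowerSeries (Fin 2) R)) = 0 :=
    fun g hg i => PowerSeries.constantCoeff_subst_eq_zero (MvPowerSeries.constantCoeff_X i) g hg
  have hv : ∀ (g : PowerSeries R), PowerSeries.constantCoeff g = 0 → ∀ i : Fin 2,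
      MvPowerSeries.constantCoeff
        (![g.subst (MvPowerSeries.X 0 : MvPowerSeries (Fin 2) R),
          g.subst (MvPowerSeries.X 1 : MvPowerSeries (Fin 2) R)] i) = 0 := by
    intro g hg i
    fin_cases i
    · exact hz g hg 0
    · exact hz g hg 1
  have sF : PowerSeries.HasSubst F.toPowerSeries :=
    PowerSeries.HasSubst.of_constantCoeff_zero F.zero_constantCoeff
  refine ⟨⟨zt, ?_⟩, ?_⟩
  · set v : Fin 2 → MvPowerSeries (Fin 2) R :=
      ![t.subst (MvPowerSeries.X 0 : MvPowerSeries (Fin 2) R),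
        t.subst (MvPowerSeries.X 1 : MvPowerSeries (Fin 2) R)] with hvdef
    have sv : MvPowerSeries.HasSubst v := MvPowerSeries.hasSubst_of_constantCoeff_zero (hv t zt)
    have sV : PowerSeries.HasSubst (F.toPowerSeries.subst v) :=
      PowerSeries.HasSubst.of_constantCoeff_zero
        (MvPowerSeries.constantCoeff_subst_eq_zero sv (hv t zt) F.zero_constantCoeff)
    -- The tuple `v` inverts `f` in each variable: `f(v_i) = f(t(X_i)) = X_i`.
    have cancel : ∀ i : Fin 2, MvPowerSeries.subst v
        (f.subst (MvPowerSeries.X i : MvPowerSeries (Fin 2) R)) = MvPowerSeries.X i := by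
      intro i
      have e : v i = t.subst (MvPowerSeries.X i : MvPowerSeries (Fin 2) R) := by
        fin_cases i <;> rfl
      rw [PowerSeries.subst_def _ f, MvPowerSeries.subst_comp_subst_apply (zX i).const sv,
        MvPowerSeries.subst_X sv, e, ← PowerSeries.subst_def,
        ← PowerSeries.subst_comp_subst_apply st (zX i), hft, PowerSeries.subst_X (zX i)]
    -- Additivity of `f` evaluated at `v`. Applying `t` to both sides then gives additivity of `t`.
    have key : f.subst (F.toPowerSeries.subst v) = F'.toPowerSeries := by
      have e := congrArg (MvPowerSeries.subst v) h.add
      rw [PowerSeries.subst_def _ f, MvPowerSeries.subst_comp_subst_apply sF.const sv,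
        MvPowerSeries.subst_comp_subst_apply
          (MvPowerSeries.hasSubst_of_constantCoeff_zero (hv f h.zero)) sv] at e
      rw [PowerSeries.subst_def, e]
      -- Reading `F'` as `F'(X_0, X_1)` leaves only the two tuples of arguments to compare.
      conv_rhs => rw [← id_eq F'.toPowerSeries, ← MvPowerSeries.subst_self]
      congr 1
      funext i
      fin_cases i
      · exact cancel 0
      · exact cancel 1
    rw [← key, ← PowerSeries.subst_comp_subst_apply sf sV, htf, PowerSeries.subst_X sV]
  · rw [PowerSeries.coeff_one_substInvOfIsUnit]
    exact Units.isUnit _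

end Inverse

/-! ### Naturality of the relative Frobenius, in terms of power series. -/

section Frobenius

variable {R : Type*} [CommRing R] (p : ℕ) [Fact p.Prime] [CharP R p]

/-- Naturality of the relative Frobenius: `f ^ (p ^ r) = (σ ^ r)^*f (x ^ (p ^ r))`. -/
theorem map_iterateFrobenius_subst_X_pow (f : PowerSeries R) (r : ℕ) :
    (PowerSeries.map (iterateFrobenius R p r) f).subst (PowerSeries.X ^ p ^ r : PowerSeries R)
      = f ^ p ^ r := by
  have hp : p ≠ 0 := (Fact.out : p.Prime).ne_zero
  rw [← PowerSeries.expand_apply _ (pow_ne_zero r hp), ← PowerSeries.map_expand]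
  exact MvPowerSeries.map_iterateFrobenius_expand p hp f r

/-- If `τ' q = Frob ^ r τ`, then `(σ ^ r)^*s τ' q = Frob ^ r s τ`. -/
theorem subst_map_comp_iterateFrobenius {K : Type*} [CommRing K] [CharP K p] (i : K →+* R)
    {s : PowerSeries K} {τ τ' q : PowerSeries R} {r : ℕ}
    (hs : PowerSeries.constantCoeff s = 0) (hτ : PowerSeries.constantCoeff τ = 0)
    (hτ' : PowerSeries.constantCoeff τ' = 0) (hq : PowerSeries.constantCoeff q = 0)
    (h : τ'.subst q = (PowerSeries.X ^ p ^ r : PowerSeries R).subst τ) :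
    PowerSeries.subst q
        ((PowerSeries.map (i.comp (iterateFrobenius K p r)) s).subst τ' : PowerSeries R)
      = (PowerSeries.X ^ p ^ r : PowerSeries R).subst ((PowerSeries.map i s).subst τ) := by
  have sτ := hasSubst_of_zero hτ
  have ss : PowerSeries.HasSubst (PowerSeries.map i s) := hasSubst_of_zero (by
    rw [← PowerSeries.coeff_zero_eq_constantCoeff_apply, PowerSeries.coeff_map,
      PowerSeries.coeff_zero_eq_constantCoeff_apply, hs, map_zero])
  have hpr : p ^ r ≠ 0 := pow_ne_zero r (Fact.out : p.Prime).ne_zero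
  -- Ring maps commute with Frobenius, so the twist by `σ ^ r` may be made over `R` instead of `K`.
  have hs' : PowerSeries.map (i.comp (iterateFrobenius K p r)) s
      = PowerSeries.map (iterateFrobenius R p r) (PowerSeries.map i s) := by
    ext d
    simp [iterateFrobenius_def]
  -- The chain is `(σ ^ r)^*s τ' q = (σ ^ r)^*s Frob ^ r τ = Frob ^ r s τ`; associativity of
  -- substitution brings `τ' q` together for `h`, and naturality does the second step.
  rw [PowerSeries.subst_comp_subst_apply (hasSubst_of_zero hτ') (hasSubst_of_zero hq), h, hs',
    ← PowerSeries.subst_comp_subst_apply (PowerSeries.HasSubst.X_pow hpr) sτ,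
    map_iterateFrobenius_subst_X_pow, ← PowerSeries.subst_comp_subst_apply ss sτ,
    PowerSeries.subst_pow ss, PowerSeries.subst_X ss]

end Frobenius

/-! ### The action of automorphisms on deformations and on rings of functions. -/

section Actions

universe v

variable {κ : Type v} [Field κ] {𝔽 : FormalGroup κ}

/-- The inverse automorphism. -/
noncomputable def stabilizerInv (s : Stabilizer 𝔽) : Stabilizer 𝔽 :=
  ⟨s.1.substInvOfIsUnit s.2.unit, s.2.inv⟩

/-- The action of automorphisms on deformations is compatible with composition. -/
theorem LevelDeformation.stab_stab_of_comp {p : ℕ} {A : Type*} [AddCommGroup A]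
    {R : CompleteLocalRing.{v}} (s t : Stabilizer 𝔽) (h : t.1.subst s.1 = PowerSeries.X)
    (X : LevelDeformation p 𝔽 A R) : (X.stab s).stab t = X := by
  have sτ := hasSubst_of_zero X.τ_iso.zero
  have ss := hasSubst_of_zero (s.2.map X.i).zero
  refine LevelDeformation.ext rfl rfl ?_ rfl
  change (PowerSeries.map X.i t.1).subst ((PowerSeries.map X.i s.1).subst X.τ) = X.τ
  rw [← PowerSeries.subst_comp_subst_apply ss sτ]
  -- The relation `t s = 1` holds over `κ`; base change along `i` carries it to the residue field,
  -- where `τ` lives.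
  have e := PowerSeries.map_subst (hasSubst_of_zero s.2.zero) (h := X.i) t.1
  rw [h] at e
  have e' : (PowerSeries.map X.i t.1).subst (PowerSeries.map X.i s.1) = PowerSeries.X :=
    e.symm.trans (PowerSeries.map_X X.i)
  rw [e', PowerSeries.subst_X sτ]

/-- The action on functions is a right action: applying `t` first and `s` second evaluates `a` at `t
· (s · X)`, so the relevant composite is `t s`. -/
theorem levelRingStab_comp_of_comp {p : ℕ} {A : Type} [AddCommGroup A] [Finite A]
    (s t : Stabilizer 𝔽) (h : t.1.subst s.1 = PowerSeries.X) (a : levelRing p 𝔽 A) :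
    levelRingStab s (levelRingStab t a) = a :=
  Subtype.ext (funext fun R => funext fun X =>
    congrArg (a.1 R) (X.stab_stab_of_comp s t h))

variable {p : ℕ} [Fact p.Prime] {n : ℕ}

theorem drinfeldStab_of (s : Stabilizer 𝔽) (k : ℕ) (f : finiteLevelRing p n 𝔽 k) :
    drinfeldStab s (Ring.DirectLimit.of (finiteLevelRing p n 𝔽)
        (fun i j h => transition p n 𝔽 i j h) k f)
      = Ring.DirectLimit.of (finiteLevelRing p n 𝔽)
        (fun i j h => transition p n 𝔽 i j h) k (levelRingStab s f) :=
  Ring.DirectLimit.map_apply_of _ _ _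

/-- Each element of the colimit comes from a finite level, and the action preserves the level. -/
theorem drinfeldStab_comp_of_comp (s t : Stabilizer 𝔽) (h : t.1.subst s.1 = PowerSeries.X)
    (a : DrinfeldRing p n 𝔽) : drinfeldStab s (drinfeldStab t a) = a := by
  obtain ⟨k, f, rfl⟩ := Ring.DirectLimit.exists_of a
  rw [drinfeldStab_of, drinfeldStab_of, levelRingStab_comp_of_comp s t h]

/-- Conjugation by `s` uses both one-sided inverse laws: this one to check the characterizing
property of the conjugate, the next to cancel `s` at the end. -/
theorem drinfeldStab_stabilizerInv (s : Stabilizer 𝔽) (a : DrinfeldRing p n 𝔽) :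
    drinfeldStab s (drinfeldStab (stabilizerInv s) a) = a :=
  drinfeldStab_comp_of_comp s (stabilizerInv s)
    (PowerSeries.subst_substInvOfIsUnit_left s.1 s.2.zero s.2.unit) a

theorem drinfeldStab_stabilizerInv_left (s : Stabilizer 𝔽) (a : DrinfeldRing p n 𝔽) :
    drinfeldStab (stabilizerInv s) (drinfeldStab s a) = a :=
  drinfeldStab_comp_of_comp (stabilizerInv s) s
    (PowerSeries.subst_substInvOfIsUnit_right s.1 s.2.zero s.2.unit) a

/-- Both maps act on the second tensor factor only, so pure tensors suffice. -/
theorem rationalize_comm {e e' : DrinfeldRing p n 𝔽 →+* DrinfeldRing p n 𝔽}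
    (h : ∀ a, e (e' a) = e' (e a)) (x : C0 p n 𝔽) :
    rationalize e (rationalize e' x) = rationalize e' (rationalize e x) := by
  induction x using TensorProduct.induction_on with
  | zero => simp only [map_zero]
  | tmul c a => exact congrArg (c ⊗ₜ[ℤ] ·) (h a)
  | add x y hx hy => simp only [map_add, hx, hy]

theorem stabC0_multiset_prod (s : Stabilizer 𝔽) (S : Multiset (C0 p n 𝔽)) :
    stabC0 s S.prod = (S.map (stabC0 s)).prod :=
  (Multiset.prod_hom S (stabC0 s).toMonoidHom).symm

/-! ### Commutation of isogenies with automorphisms. -/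

variable [CharP κ p]

/-- The actions of isogenies and of automorphisms on deformations with level structure commute:
`φ · (s · X) = s · (φ · X)`. -/
theorem IsIsogQuotient.stab {φ : Isog p n} {k j : ℕ}
    {hφ : ∀ t, φ.toHom t ∈ torsion p n k → t ∈ torsion p n j} {R : CompleteLocalRing.{v}}
    {X : LevelDeformation p 𝔽 (torsion p n j) R} {Y : LevelDeformation p 𝔽 (torsion p n k) R}
    (h : IsIsogQuotient φ hφ X Y) (s : Stabilizer 𝔽) :
    IsIsogQuotient φ hφ (X.stab s) (Y.stab s) := by
  obtain ⟨r, q, hr, hq, hdiv, hl, hi, hτ⟩ := h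
  -- An automorphism leaves `𝔾`, `i` and `l` untouched, so the same `r` and `q` work and only the
  -- condition on `τ` is left.
  refine ⟨r, q, hr, hq, hdiv, hl, hi, ?_⟩
  -- `R` itself may have mixed characteristic; the Frobenius argument takes place in the residue
  -- field, which contains `κ` through `i`.
  have : CharP (ResidueField R) p := charP_of_injective_ringHom X.i.injective p
  have e := subst_map_comp_iterateFrobenius p X.i s.2.zero X.τ_iso.zero Y.τ_iso.zero
    (hq.map (residue R)).zero hτ
  rw [← hi] at e
  exact e

/-- Pulling back along an isogeny is compatible with the action of an automorphism. -/
theorem IsIsogPullback.stab {φ : Isog p n} {a b : DrinfeldRing p n 𝔽}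
    (h : IsIsogPullback φ a b) (s : Stabilizer 𝔽) :
    IsIsogPullback φ (drinfeldStab s a) (drinfeldStab s b) := by
  obtain ⟨k, j, hφ, f, g, rfl, rfl, hfg⟩ := h
  -- With `Y = φ · X`, the pair `(s · X, s · Y)` is again related by `φ`, so `g(s · X) = f(s · Y)`.
  exact ⟨k, j, hφ, levelRingStab s f, levelRingStab s g, drinfeldStab_of s k f,
    drinfeldStab_of s j g, fun R X Y hXY => hfg R (X.stab s) (Y.stab s) (hXY.stab s)⟩

/-- The actions of isogenies and of automorphisms on the Drinfeld ring commute. The conjugate of the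
action of an isogeny by an automorphism has the property which characterizes that action. -/
theorem drinfeldIsog_drinfeldStab (φ : Isog p n) (s : Stabilizer 𝔽) (a : DrinfeldRing p n 𝔽) :
    drinfeldIsog φ (drinfeldStab s a) = drinfeldStab s (drinfeldIsog φ a) := by
  unfold drinfeldIsog
  split_ifs with h
  -- For the chosen `e`, the property at `s⁻¹ b`, transported by `s`, says that `s e s⁻¹` has the
  -- property at `b`. Uniqueness gives `e = s e s⁻¹`.
  · have hc : h.choose = (drinfeldStab s).comp (h.choose.comp (drinfeldStab (stabilizerInv s))) :=
      (h.choose_spec.2 _ fun b => by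
        have e := (h.choose_spec.1 (drinfeldStab (stabilizerInv s) b)).stab s
        rwa [drinfeldStab_stabilizerInv] at e).symm
    conv_lhs => rw [hc]
    simp only [RingHom.comp_apply, drinfeldStab_stabilizerInv_left]
  -- Here the action of `φ` is by default the identity.
  · rfl

theorem isogC0_stabC0 (φ : Isog p n) (s : Stabilizer 𝔽) (x : C0 p n 𝔽) :
    isogC0 φ (stabC0 s x) = stabC0 s (isogC0 φ x) :=
  rationalize_comm (drinfeldIsog_drinfeldStab φ s) x

end Actions

end MoravaCharacter

/-- On a representative `β` both sides become products indexed by the same `orbitSum`, with `f`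
evaluated at the same classes; the factors agree by `isogC0_stabC0`. -/
theorem mainTheorem3 (p : ℕ) [Fact p.Prime] (n : ℕ) {κ : Type u} [Field κ] [CharP κ p]
    [PerfectRing κ p] (𝔽 : FormalGroup κ) [𝔽.IsComm] (hF : MoravaCharacter.HasHeight p n 𝔽)
    (φ : MoravaCharacter.IsogSection p n) (G : Type*) [Group G] [Finite G] (m : ℕ)
    (s : MoravaCharacter.Stabilizer 𝔽)
    (f : MoravaCharacter.ClassFunction p n G (MoravaCharacter.C0 p n 𝔽)) :
    MoravaCharacter.powerOp φ m (MoravaCharacter.stabClass s f) =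
      MoravaCharacter.stabClass s (MoravaCharacter.powerOp φ m f) := by
  funext c
  induction c using Quotient.inductionOn with
  | h β =>
    refine Eq.trans ?_ (MoravaCharacter.stabC0_multiset_prod s _).symm
    rw [Multiset.map_map]
    exact congrArg Multiset.prod
      (Multiset.map_congr rfl fun H _ => MoravaCharacter.isogC0_stabC0 (φ.1 H) s _)
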